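/- \textbf{Rank-one transformations.} Fix integers $r_n\ge 2$ and $s_{n,i}\ge 0$ ($n\ge 0$, $0\le i\le r_n-1$). Columns $C_n$, each a finite stack of $h_n$ disjoint intervals (levels) of equal length, are built inductively. $C_0$ is the single level $[0,1)$. To obtain $C_{n+1}$, cut $C_n$ into $r_n$ subcolumns of equal width, put $s_{n,i}$ new intervals (spacers) of the same width on top of the $i$-th subcolumn, where each new spacer is placed on the line immediately to the right of everything chosen before, and stack each subcolumn on top of the subcolumn to its left. Thus $h_0=1$ and $h_{n+1}=\sum_{i=0}^{r_n-1}(h_n+s_{n,i})$. The column map of $C_n$ translates each level except the top one onto the level directly above it. The rank-one transformation $T$ is the pointwise limit of the column maps; it acts on $X=\bigcup_n C_n$ with Lebesgue measure. It is infinite if $X$ has infinite measure, and it has bounded cuts if $\sup_n r_n<\infty$. A skyscraper transformation is an infinite rank-one transformation with $r_n=2$ and $s_{n,0}=0$ for all $n$. \textbf{Corollary.} Let $T$ be an infinite rank-one transformation with bounded cuts such that $s_{n-1,r_{n-1}-1}\ge h_n/2$ for all $n\ge 1$. Then there exists a skyscraper transformation $S$ such that $T\times S$, acting on the product space with the product measure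 (which it preserves), is conservative but not ergodic. The hypotheses on $T$ hold in particular for the infinite Chac\'on transformation ($r_n=3$, $s_{n,0}=0$, $s_{n,1}=1$, $s_{n,2}=3h_n+1$) and for the Hajian--Kakutani skyscraper transformation ($r_n=2$, $s_{n,0}=0$, $s_{n,1}=2h_n$). -/

import Mathlib

open MeasureTheory Filter

noncomputable section

/-- Parameters of a cutting-and-stacking construction: at stage `n` the column is cut into
`r n ≥ 2` subcolumns, and `s n i` spacers are put on top of the `i`-th subcolumn, `i < r n`
(the values `s n i` with `i ≥ r n` are never used). -/
structure RankOne where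
  r : ℕ → ℕ
  s : ℕ → ℕ → ℕ
  two_le_r : ∀ n, 2 ≤ r n

namespace RankOne

/-- The height `h_n` of the column `C_n`. -/
def height (P : RankOne) : ℕ → ℕ
  | 0 => 1
  | n + 1 => ∑ i ∈ Finset.range (P.r n), (P.height n + P.s n i)

/-- The common length of the levels of `C_n`. -/
def width (P : RankOne) (n : ℕ) : ℝ := 1 / ∏ k ∈ Finset.range n, (P.r k : ℝ)

/-- The left endpoints of the levels of `C_n`, listed from the bottom level to the top level.
`C_0` is the single level `[0,1)`. For `C_{n+1}`, each level of `C_n` is cut into `r_n` intervals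
of equal length; the `i`-th subcolumn consists of the `i`-th pieces, with `s_{n,i}` spacers on top;
each subcolumn is stacked on top of the one to its left. The union of the levels of `C_n` is
`[0, h_n w_n)`, and the new spacers are placed one after the other immediately to its right. -/
def column (P : RankOne) : ℕ → List ℝ
  | 0 => [0]
  | n + 1 => (List.range (P.r n)).flatMap fun (i : ℕ) =>
      ((P.column n).map fun a => a + (i : ℝ) * P.width (n + 1)) ++
      ((List.range (P.s n i)).map fun (t : ℕ) =>
        (P.height n : ℝ) * P.width n +
          ((∑ k ∈ Finset.range i, (P.s n k : ℝ)) + (t : ℝ)) * P.width (n + 1))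

theorem length_column (P : RankOne) (n : ℕ) : (P.column n).length = P.height n := by
  induction n with
  | zero => rfl
  | succ n ih =>
    simp only [column, height, List.length_flatMap, List.length_append, List.length_map, List.length_range, ih]
    rfl

/-- The left endpoint of the level of height `j` in `C_n` (for `j < h_n`). -/
def left (P : RankOne) (n j : ℕ) : ℝ := (P.column n).getD j 0

/-- The level `I_{n,j}` of height `j` in `C_n` (for `j < h_n`). -/
def level (P : RankOne) (n j : ℕ) : Set ℝ := Set.Ico (P.left n j) (P.left n j + P.width n)

/-- The space on which the transformation lives: the union of all the columns. -/
def space (P : RankOne) : Set ℝ := ⋃ n, ⋃ j, ⋃ (_ : j < P.height n), P.level n j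

/-- Lebesgue measure on the space. -/
def measure (P : RankOne) : Measure ℝ := volume.restrict P.space

/-- The column map of `C_n`: every level except the top one is translated onto the level
immediately above it. It is extended by the identity to the rest of the line. -/
def columnMap (P : RankOne) (n : ℕ) (x : ℝ) : ℝ :=
  x + ∑ j ∈ Finset.range (P.height n - 1),
    (P.level n j).indicator (fun _ => P.left n (j + 1) - P.left n j) x

/-- The rank-one transformation: the pointwise limit of the column maps. At each point the
sequence of column maps is eventually constant. -/
def map (P : RankOne) (x : ℝ) : ℝ := limUnder atTop fun n => P.columnMap n x

/-- The transformation is infinite: its space has infinite measure. -/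
def IsInfinite (P : RankOne) : Prop := P.measure Set.univ = ⊤

/-- Bounded cuts: `sup r_n < ∞`. -/
def BoundedCuts (P : RankOne) : Prop := ∃ R : ℕ, ∀ n, P.r n ≤ R

/-- `s_{n-1, r_{n-1}-1} ≥ h_n / 2` for all `n ≥ 1`. -/
def LargeLastSpacers (P : RankOne) : Prop :=
  ∀ n, 1 ≤ n → (P.height n : ℝ) / 2 ≤ (P.s (n - 1) (P.r (n - 1) - 1) : ℝ)

/-- A skyscraper transformation: an infinite rank-one transformation where each column is cut into
two subcolumns and spacers are added to the right subcolumn only. -/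
def IsSkyscraper (P : RankOne) : Prop :=
  (∀ n, P.r n = 2) ∧ (∀ n, P.s n 0 = 0) ∧ P.IsInfinite

/-- Heights of the columns of the infinite Chacón transformation. -/
def chaconHeight : ℕ → ℕ
  | 0 => 1
  | n + 1 => 2 * (3 * chaconHeight n + 1)

/-- The infinite Chacón transformation: cut into three, add no spacer to the left subcolumn,
one spacer to the middle one and `3 h_n + 1` spacers to the right one. -/
def chacon : RankOne where
  r _ := 3
  s n i := if i = 0 then 0 else if i = 1 then 1 else 3 * chaconHeight n + 1
  two_le_r _ := by norm_num

theorem height_chacon (n : ℕ) : chacon.height n = chaconHeight n := by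
  induction n with
  | zero => rfl
  | succ n ih =>
    have hr : chacon.r n = 3 := rfl
    have h0 : chacon.s n 0 = 0 := rfl
    have h1 : chacon.s n 1 = 1 := rfl
    have h2 : chacon.s n 2 = 3 * chaconHeight n + 1 := rfl
    simp only [height, chaconHeight, ih, hr, h0, h1, h2, Finset.sum_range_succ,
      Finset.sum_range_zero]
    ring

/-- The Hajian–Kakutani skyscraper transformation: cut into two, add no spacer to the left
subcolumn and `2 h_n` spacers to the right one, so that `h_n = 4 ^ n`. -/
def hajianKakutani : RankOne where
  r _ := 2
  s n i := if i = 0 then 0 else 2 * 4 ^ n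
  two_le_r _ := le_rfl

theorem height_hajianKakutani (n : ℕ) : hajianKakutani.height n = 4 ^ n := by
  induction n with
  | zero => rfl
  | succ n ih =>
    have hr : hajianKakutani.r n = 2 := rfl
    have h0 : hajianKakutani.s n 0 = 0 := rfl
    have h1 : hajianKakutani.s n 1 = 2 * 4 ^ n := rfl
    simp only [height, ih, hr, h0, h1, Finset.sum_range_succ, Finset.sum_range_zero]
    ring

end RankOne

end

namespace RankOne

theorem getD_flatMap_range {α : Type*} (f : ℕ → List α) (d : α) (r i j : ℕ) (hi : i < r)
    (hj : j < (f i).length) :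
    ((List.range r).flatMap f).getD (∑ k ∈ Finset.range i, (f k).length + j) d
      = (f i).getD j d := by
  have hlen : ∀ r, ((List.range r).flatMap f).length = ∑ k ∈ Finset.range r, (f k).length := by
    intro r
    rw [List.length_flatMap]
    rfl
  induction r with
  | zero => omega
  | succ r ih =>
    rw [List.range_succ, List.flatMap_append]
    rcases Nat.lt_succ_iff_lt_or_eq.1 hi with h | rfl
    · rw [List.getD_append, ih h]
      rw [hlen]
      calc _ < ∑ k ∈ Finset.range i, (f k).length + (f i).length := by omega
        _ = ∑ k ∈ Finset.range (i + 1), (f k).length := (Finset.sum_range_succ _ _).symm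
        _ ≤ _ := Finset.sum_le_sum_of_subset (Finset.range_mono h)
    · rw [List.getD_append_right _ _ _ _ (by rw [hlen]; omega), hlen]
      simp

theorem exists_eq_sum_range_add (s : ℕ → ℕ) (r b : ℕ) (hb : b < ∑ k ∈ Finset.range r, s k) :
    ∃ i < r, ∃ t < s i, b = ∑ k ∈ Finset.range i, s k + t := by
  induction r with
  | zero => simp at hb
  | succ r ih =>
    by_cases h : b < ∑ k ∈ Finset.range r, s k
    · obtain ⟨i, hi, t, ht, e⟩ := ih h
      exact ⟨i, by omega, t, ht, e⟩
    · rw [Finset.sum_range_succ] at hb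
      exact ⟨r, by omega, b - ∑ k ∈ Finset.range r, s k, by omega, by omega⟩

variable (P : RankOne)

theorem r_pos (n : ℕ) : 0 < P.r n := by
  have := P.two_le_r n
  omega

theorem width_pos (n : ℕ) : 0 < P.width n := by
  unfold width
  have : 0 < ∏ k ∈ Finset.range n, (P.r k : ℝ) :=
    Finset.prod_pos fun k _ => by exact_mod_cast P.r_pos k
  positivity

theorem width_eq_mul (n : ℕ) : P.width n = P.r n * P.width (n + 1) := by
  have h : (P.r n : ℝ) ≠ 0 := by exact_mod_cast (P.r_pos n).ne'
  unfold width
  rw [Finset.prod_range_succ]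
  field_simp

theorem width_le (n : ℕ) : P.width n ≤ (1 / 2) ^ n := by
  induction n with
  | zero => simp [width]
  | succ n ih =>
    have h1 := P.width_eq_mul n
    have h2 : (2 : ℝ) ≤ P.r n := by exact_mod_cast P.two_le_r n
    have h3 := P.width_pos (n + 1)
    have h4 : 2 * P.width (n + 1) ≤ P.width n := by rw [h1]; gcongr
    rw [pow_succ]
    linarith

theorem tendsto_width : Tendsto P.width atTop (nhds 0) :=
  squeeze_zero (fun n => (P.width_pos n).le) P.width_le
    (tendsto_pow_atTop_nhds_zero_of_lt_one (by norm_num) (by norm_num))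

/-- The height in `C_{n+1}` of the bottom of the `i`-th subcolumn of `C_n`. -/
def offset (n i : ℕ) : ℕ := ∑ k ∈ Finset.range i, (P.height n + P.s n k)

theorem height_succ (n : ℕ) : P.height (n + 1) = P.offset n (P.r n) := rfl

theorem offset_zero (n : ℕ) : P.offset n 0 = 0 := rfl

theorem offset_succ (n i : ℕ) : P.offset n (i + 1) = P.offset n i + (P.height n + P.s n i) :=
  Finset.sum_range_succ _ _

theorem offset_mono (n : ℕ) : Monotone (P.offset n) :=
  monotone_nat_of_le_succ fun i => by rw [offset_succ]; omega

theorem offset_add_height_le {n i k : ℕ} (h : i < k) :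
    P.offset n i + P.height n ≤ P.offset n k := by
  have := P.offset_mono n (Nat.succ_le_of_lt h)
  rw [Nat.succ_eq_add_one, offset_succ] at this
  omega

theorem height_pos (n : ℕ) : 0 < P.height n := by
  induction n with
  | zero => exact Nat.one_pos
  | succ n ih =>
    have := P.offset_add_height_le (n := n) (P.r_pos n)
    rw [height_succ]
    omega

theorem left_succ {n i j : ℕ} (hi : i < P.r n) (hj : j < P.height n) :
    P.left (n + 1) (P.offset n i + j) = P.left n j + i * P.width (n + 1) := by
  unfold left
  rw [column]
  set f : ℕ → List ℝ := fun i => ((P.column n).map fun a => a + (i : ℝ) * P.width (n + 1)) ++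
      ((List.range (P.s n i)).map fun (t : ℕ) =>
        (P.height n : ℝ) * P.width n +
          ((∑ k ∈ Finset.range i, (P.s n k : ℝ)) + (t : ℝ)) * P.width (n + 1)) with hf
  have hlen : ∀ k, (f k).length = P.height n + P.s n k := by
    intro k
    simp [hf, length_column]
  have ho : P.offset n i = ∑ k ∈ Finset.range i, (f k).length := by
    simp only [hlen, offset]
  have hj' : j < (P.column n).length := by rwa [length_column]
  rw [ho, getD_flatMap_range f 0 _ i j hi (by rw [hlen]; omega), hf]
  dsimp only
  rw [List.getD_append _ _ _ _ (by simpa using hj'), List.getD_eq_getElem _ _ (by simpa using hj'),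
    List.getElem_map, List.getD_eq_getElem _ _ hj']

theorem left_zero (n : ℕ) : P.left n 0 = 0 := by
  induction n with
  | zero => rfl
  | succ n ih =>
    have := P.left_succ (P.r_pos n) (P.height_pos n)
    simpa [offset_zero, ih] using this

theorem mul_width_mem_column (n a : ℕ) (ha : a < P.height n) :
    (a : ℝ) * P.width n ∈ P.column n := by
  induction n generalizing a with
  | zero =>
    have : a = 0 := Nat.lt_one_iff.1 ha
    simp [this, column]
  | succ n ih =>
    rw [column, List.mem_flatMap]
    have hw := P.width_eq_mul n
    by_cases h : a < P.height n * P.r n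
    · refine ⟨a % P.r n, List.mem_range.2 (Nat.mod_lt _ (P.r_pos n)), ?_⟩
      refine List.mem_append_left _ (List.mem_map.2
        ⟨_, ih (a / P.r n) (Nat.div_lt_of_lt_mul (by rwa [mul_comm])), ?_⟩)
      have e : (a : ℝ) = P.r n * (a / P.r n : ℕ) + (a % P.r n : ℕ) := by
        exact_mod_cast (Nat.div_add_mod a (P.r n)).symm
      rw [hw]
      conv_rhs => rw [e]
      ring
    · have hh : P.height (n + 1) = P.height n * P.r n + ∑ k ∈ Finset.range (P.r n), P.s n k := by
        rw [height, Finset.sum_add_distrib]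
        simp [mul_comm]
      obtain ⟨i, hi, t, ht, e⟩ := exists_eq_sum_range_add (P.s n) (P.r n)
        (a - P.height n * P.r n) (by omega)
      refine ⟨i, List.mem_range.2 hi, List.mem_append_right _ (List.mem_map.2
        ⟨t, List.mem_range.2 ht, ?_⟩)⟩
      have e' : a = P.height n * P.r n + (∑ k ∈ Finset.range i, P.s n k + t) := by omega
      rw [hw, e']
      push_cast
      ring

theorem column_perm (n : ℕ) :
    ((List.range (P.height n)).map fun a : ℕ => (a : ℝ) * P.width n).Perm (P.column n) := by
  have hnd : ((List.range (P.height n)).map fun a : ℕ => (a : ℝ) * P.width n).Nodup :=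
    List.Nodup.map (fun a b h => by
      have := mul_right_cancel₀ (P.width_pos n).ne' h
      exact_mod_cast this) List.nodup_range
  refine (List.subperm_of_subset hnd fun x hx => ?_).perm_of_length_le ?_
  · obtain ⟨a, ha, rfl⟩ := List.mem_map.1 hx
    exact P.mul_width_mem_column n a (List.mem_range.1 ha)
  · simp [length_column]

theorem exists_left_eq (n j : ℕ) (hj : j < P.height n) :
    ∃ a < P.height n, P.left n j = a * P.width n := by
  have hj' : j < (P.column n).length := by rwa [length_column]
  have h : P.left n j ∈ P.column n := by
    rw [left, List.getD_eq_getElem _ _ hj']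
    exact List.getElem_mem hj'
  obtain ⟨a, ha, e⟩ := List.mem_map.1 ((P.column_perm n).mem_iff.2 h)
  exact ⟨a, List.mem_range.1 ha, e.symm⟩

theorem exists_eq_left (n a : ℕ) (ha : a < P.height n) :
    ∃ j < P.height n, P.left n j = a * P.width n := by
  obtain ⟨j, hj, e⟩ := List.getElem_of_mem (P.mul_width_mem_column n a ha)
  refine ⟨j, by rwa [length_column] at hj, ?_⟩
  rw [left, List.getD_eq_getElem _ _ hj, e]

theorem left_injective {n j k : ℕ} (hj : j < P.height n) (hk : k < P.height n)
    (h : P.left n j = P.left n k) : j = k := by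
  have hj' : j < (P.column n).length := by rwa [length_column]
  have hk' : k < (P.column n).length := by rwa [length_column]
  have hnd : (P.column n).Nodup := by
    refine (P.column_perm n).nodup_iff.1 (List.Nodup.map (fun a b h => ?_) List.nodup_range)
    have := mul_right_cancel₀ (P.width_pos n).ne' h
    exact_mod_cast this
  rw [left, left, List.getD_eq_getElem _ _ hj', List.getD_eq_getElem _ _ hk'] at h
  exact (hnd.getElem_inj_iff).1 h

theorem level_unique {n j k : ℕ} {x : ℝ} (hj : j < P.height n) (hk : k < P.height n)
    (hx : x ∈ P.level n j) (hx' : x ∈ P.level n k) : j = k := by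
  obtain ⟨a, -, ea⟩ := P.exists_left_eq n j hj
  obtain ⟨b, -, eb⟩ := P.exists_left_eq n k hk
  refine P.left_injective hj hk ?_
  have hw := P.width_pos n
  simp only [level, Set.mem_Ico, ea, eb] at hx hx'
  have h1 : (a : ℝ) < b + 1 := by
    refine lt_of_mul_lt_mul_right ?_ hw.le
    linarith
  have h2 : (b : ℝ) < a + 1 := by
    refine lt_of_mul_lt_mul_right ?_ hw.le
    linarith
  have h1' : a < b + 1 := by exact_mod_cast h1
  have h2' : b < a + 1 := by exact_mod_cast h2
  rw [ea, eb, show a = b by omega]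

theorem measurableSet_level (n j : ℕ) : MeasurableSet (P.level n j) := measurableSet_Ico

theorem volume_level (n j : ℕ) : volume (P.level n j) = ENNReal.ofReal (P.width n) := by
  simp [level]

theorem level_zero_eq (n : ℕ) : P.level n 0 = Set.Ico 0 (P.width n) := by
  simp [level, left_zero]

theorem mem_Ico_iff_exists_level (n : ℕ) (x : ℝ) :
    x ∈ Set.Ico 0 (P.height n * P.width n) ↔ ∃ j < P.height n, x ∈ P.level n j := by
  have hw := P.width_pos n
  constructor
  · rintro ⟨h0, h1⟩
    have hd : 0 ≤ x / P.width n := by positivity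
    have hlt : x / P.width n < P.height n := by rwa [div_lt_iff₀ hw]
    obtain ⟨j, hj, e⟩ := P.exists_eq_left n ⌊x / P.width n⌋₊ ((Nat.floor_lt hd).2 hlt)
    refine ⟨j, hj, ?_, ?_⟩
    · rw [e, ← le_div_iff₀ hw]
      exact Nat.floor_le hd
    · rw [e, ← add_one_mul, ← div_lt_iff₀ hw]
      exact Nat.lt_floor_add_one _
  · rintro ⟨j, hj, h0, h1⟩
    obtain ⟨a, ha, e⟩ := P.exists_left_eq n j hj
    rw [e] at h0 h1
    refine ⟨le_trans (by positivity) h0, lt_of_lt_of_le h1 ?_⟩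
    rw [← add_one_mul]
    gcongr
    exact_mod_cast ha

theorem mem_space_iff (x : ℝ) : x ∈ P.space ↔ ∃ n, ∃ j < P.height n, x ∈ P.level n j := by
  simp [space]

theorem measurableSet_space : MeasurableSet P.space :=
  .iUnion fun n => .iUnion fun j => .iUnion fun _ => P.measurableSet_level n j

theorem offset_add_lt_height {n i j : ℕ} (hi : i < P.r n) (hj : j < P.height n) :
    P.offset n i + j < P.height (n + 1) := by
  have := P.offset_add_height_le (n := n) hi
  rw [height_succ]
  omega

theorem level_succ_subset {n i j : ℕ} (hi : i < P.r n) (hj : j < P.height n) :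
    P.level (n + 1) (P.offset n i + j) ⊆ P.level n j := by
  have hw := P.width_pos (n + 1)
  have hi' : (i : ℝ) + 1 ≤ P.r n := by exact_mod_cast hi
  rw [level, level, P.left_succ hi hj, P.width_eq_mul n]
  apply Set.Ico_subset_Ico
  · have : 0 ≤ i * P.width (n + 1) := by positivity
    linarith
  · have := mul_le_mul_of_nonneg_right hi' hw.le
    linarith

theorem exists_level_succ {n j : ℕ} {x : ℝ} (hj : j < P.height n) (hx : x ∈ P.level n j) :
    ∃ i < P.r n, x ∈ P.level (n + 1) (P.offset n i + j) := by
  have hw := P.width_pos (n + 1)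
  obtain ⟨h0, h1⟩ := hx
  rw [P.width_eq_mul n] at h1
  have hd : 0 ≤ (x - P.left n j) / P.width (n + 1) := div_nonneg (by linarith) hw.le
  have hlt : (x - P.left n j) / P.width (n + 1) < P.r n := by
    rw [div_lt_iff₀ hw]
    linarith
  have hi := (Nat.floor_lt hd).2 hlt
  refine ⟨_, hi, ?_⟩
  rw [level, P.left_succ hi hj]
  have h2 := Nat.floor_le hd
  have h3 := Nat.lt_floor_add_one ((x - P.left n j) / P.width (n + 1))
  rw [le_div_iff₀ hw] at h2
  rw [div_lt_iff₀ hw] at h3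
  constructor <;> linarith

theorem columnMap_of_mem {n j : ℕ} {x : ℝ} (hj : j + 1 < P.height n) (hx : x ∈ P.level n j) :
    P.columnMap n x = x + (P.left n (j + 1) - P.left n j) := by
  rw [columnMap, Finset.sum_eq_single_of_mem j (Finset.mem_range.2 (by omega)),
    Set.indicator_of_mem hx]
  intro k hk hkj
  refine Set.indicator_of_notMem (fun hxk => hkj ?_) _
  have := Finset.mem_range.1 hk
  exact P.level_unique (by omega) (by omega) hxk hx

theorem columnMap_of_notMem_space {n : ℕ} {x : ℝ} (hx : x ∉ P.space) : P.columnMap n x = x := by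
  rw [columnMap, Finset.sum_eq_zero, add_zero]
  intro k hk
  have := Finset.mem_range.1 hk
  exact Set.indicator_of_notMem
    (fun hxk => hx ((P.mem_space_iff x).2 ⟨n, k, by omega, hxk⟩)) _

theorem exists_left_sub_eq {n m j : ℕ} {x : ℝ} (h : n ≤ m) (hj : j + 1 < P.height n)
    (hx : x ∈ P.level n j) : ∃ k, k + 1 < P.height m ∧ x ∈ P.level m k ∧
      P.left m (k + 1) - P.left m k = P.left n (j + 1) - P.left n j := by
  induction m, h using Nat.le_induction with
  | base => exact ⟨j, hj, hx, rfl⟩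
  | succ m _ ih =>
    obtain ⟨k, hk, hxk, e⟩ := ih
    obtain ⟨i, hi, hxi⟩ := P.exists_level_succ (by omega) hxk
    refine ⟨_, ?_, hxi, ?_⟩
    · rw [add_assoc]
      exact P.offset_add_lt_height hi hk
    · rw [add_assoc, P.left_succ hi hk, P.left_succ hi (by omega), ← e]
      ring

theorem columnMap_of_le {n m j : ℕ} {x : ℝ} (h : n ≤ m) (hj : j + 1 < P.height n)
    (hx : x ∈ P.level n j) : P.columnMap m x = x + (P.left n (j + 1) - P.left n j) := by
  obtain ⟨k, hk, hxk, e⟩ := P.exists_left_sub_eq h hj hx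
  rw [P.columnMap_of_mem hk hxk, e]

theorem map_of_mem {n j : ℕ} {x : ℝ} (hj : j + 1 < P.height n) (hx : x ∈ P.level n j) :
    P.map x = x + (P.left n (j + 1) - P.left n j) :=
  (tendsto_const_nhds.congr' (eventually_atTop.2
    ⟨n, fun _ hm => (P.columnMap_of_le hm hj hx).symm⟩)).limUnder_eq

theorem map_of_notMem_space {x : ℝ} (hx : x ∉ P.space) : P.map x = x :=
  (tendsto_const_nhds.congr fun _ => (P.columnMap_of_notMem_space hx).symm).limUnder_eq

theorem add_left_sub_mem_level {n j k : ℕ} {x : ℝ} :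
    x + (P.left n k - P.left n j) ∈ P.level n k ↔ x ∈ P.level n j := by
  simp only [level, Set.mem_Ico]
  constructor <;> rintro ⟨h0, h1⟩ <;> constructor <;> linarith

theorem map_mem_level {n j : ℕ} {x : ℝ} (hj : j + 1 < P.height n) (hx : x ∈ P.level n j) :
    P.map x ∈ P.level n (j + 1) := by
  rw [P.map_of_mem hj hx, add_left_sub_mem_level]
  exact hx

theorem iterate_map_of_mem {n j k : ℕ} {x : ℝ} (hj : j + k < P.height n) (hx : x ∈ P.level n j) :
    P.map^[k] x = x + (P.left n (j + k) - P.left n j) := by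
  induction k with
  | zero => simp
  | succ k ih =>
    have ih' := ih (by omega)
    rw [Function.iterate_succ_apply', ih', P.map_of_mem (j := j + k) (by omega)
      (P.add_left_sub_mem_level.2 hx), ← add_assoc j k 1]
    ring

/-- At least one spacer is put on top of the last subcolumn at every stage. -/
def HasLastSpacer : Prop := ∀ n, 1 ≤ P.s n (P.r n - 1)

variable {P}

theorem offset_add_succ_lt_height (hP : P.HasLastSpacer) {n i j : ℕ} (hi : i < P.r n)
    (hj : j < P.height n) : P.offset n i + j + 1 < P.height (n + 1) := by
  have h1 := P.offset_succ n (P.r n - 1)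
  have h2 := P.offset_mono n (show i ≤ P.r n - 1 by omega)
  have h3 := hP n
  rw [Nat.sub_add_cancel (P.r_pos n), ← height_succ] at h1
  omega

theorem exists_forall_ge_level (hP : P.HasLastSpacer) {x : ℝ} (hx : x ∈ P.space) :
    ∃ N, ∀ n ≥ N, ∃ j, j + 1 < P.height n ∧ x ∈ P.level n j := by
  obtain ⟨n, j, hj, hxj⟩ := (P.mem_space_iff x).1 hx
  refine ⟨n + 1, fun m hm => ?_⟩
  obtain ⟨i, hi, hxi⟩ := P.exists_level_succ hj hxj
  obtain ⟨k, hk, hxk, -⟩ :=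
    P.exists_left_sub_eq hm (offset_add_succ_lt_height hP hi hj) hxi
  exact ⟨k, hk, hxk⟩

theorem map_mem_space (hP : P.HasLastSpacer) {x : ℝ} : P.map x ∈ P.space ↔ x ∈ P.space := by
  by_cases hx : x ∈ P.space
  · obtain ⟨N, hN⟩ := exists_forall_ge_level hP hx
    obtain ⟨j, hj, hxj⟩ := hN N le_rfl
    exact iff_of_true ((P.mem_space_iff _).2 ⟨N, j + 1, hj, P.map_mem_level hj hxj⟩) hx
  · rw [P.map_of_notMem_space hx]

theorem measurable_columnMap (n : ℕ) : Measurable (P.columnMap n) :=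
  measurable_id.add (Finset.measurable_fun_sum _ fun j _ =>
    measurable_const.indicator (P.measurableSet_level n j))

theorem tendsto_columnMap (hP : P.HasLastSpacer) (x : ℝ) :
    Tendsto (fun n => P.columnMap n x) atTop (nhds (P.map x)) := by
  by_cases hx : x ∈ P.space
  · obtain ⟨N, hN⟩ := exists_forall_ge_level hP hx
    obtain ⟨j, hj, hxj⟩ := hN N le_rfl
    rw [P.map_of_mem hj hxj]
    exact tendsto_const_nhds.congr' (eventually_atTop.2
      ⟨N, fun _ hm => (P.columnMap_of_le hm hj hxj).symm⟩)
  · rw [P.map_of_notMem_space hx]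
    exact tendsto_const_nhds.congr fun _ => (P.columnMap_of_notMem_space hx).symm

theorem measurable_map (hP : P.HasLastSpacer) : Measurable P.map :=
  measurable_of_tendsto_metrizable measurable_columnMap
    (tendsto_pi_nhds.2 (tendsto_columnMap hP))

theorem volume_preimage_inter_level {n j : ℕ} (hj : j + 1 < P.height n) (A : Set ℝ) :
    volume (P.map ⁻¹' A ∩ P.level n j) = volume (A ∩ P.level n (j + 1)) := by
  rw [← measure_preimage_add_right volume (P.left n (j + 1) - P.left n j)
    (A ∩ P.level n (j + 1))]
  congr 1
  ext x
  simp only [Set.mem_inter_iff, Set.mem_preimage, add_left_sub_mem_level]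
  refine and_congr_left fun hx => ?_
  rw [P.map_of_mem hj hx]

theorem volume_inter_biUnion_level (n : ℕ) (A : Set ℝ) (hA : MeasurableSet A) (c : ℕ)
    (hc : c ≤ 1) :
    volume (A ∩ ⋃ j ∈ Finset.range (P.height n - 1), P.level n (j + c))
      = ∑ j ∈ Finset.range (P.height n - 1), volume (A ∩ P.level n (j + c)) := by
  rw [Set.inter_iUnion₂, measure_biUnion_finset]
  · intro j hj k hk hjk
    have hj' := Finset.mem_range.1 (Finset.mem_coe.1 hj)
    have hk' := Finset.mem_range.1 (Finset.mem_coe.1 hk)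
    refine Set.disjoint_left.2 fun x hx hx' => hjk ?_
    have := P.level_unique (by omega) (by omega) hx.2 hx'.2
    omega
  · exact fun j _ => hA.inter (P.measurableSet_level n _)

theorem measurePreserving_map (hP : P.HasLastSpacer) :
    MeasurePreserving P.map P.measure P.measure := by
  refine ⟨measurable_map hP, Measure.ext fun A hA => ?_⟩
  have hTA := measurable_map hP hA
  rw [Measure.map_apply (measurable_map hP) hA, measure, Measure.restrict_apply hTA,
    Measure.restrict_apply hA]
  set G : ℕ → ℕ → Set ℝ := fun c n =>
    ⋃ j ∈ Finset.range (P.height n - 1), P.level n (j + c) with hG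
  have hmem : ∀ c n x, x ∈ G c n ↔ ∃ j, j + 1 < P.height n ∧ x ∈ P.level n (j + c) := by
    intro c n x
    simp only [hG, Set.mem_iUnion, Finset.mem_range, exists_prop, Nat.lt_sub_iff_add_lt]
  have hmono : ∀ c ≤ 1, Monotone (G c) := by
    intro c hc
    refine monotone_nat_of_le_succ fun n x hx => ?_
    obtain ⟨j, hj, hxj⟩ := (hmem c n x).1 hx
    obtain ⟨i, hi, hxi⟩ := P.exists_level_succ (by omega) hxj
    rw [← add_assoc] at hxi
    refine (hmem c _ x).2 ⟨_, ?_, hxi⟩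
    rw [add_assoc]
    exact P.offset_add_lt_height hi hj
  have hG0 : (⋃ n, G 0 n) = P.space := by
    ext x
    simp only [Set.mem_iUnion, hmem]
    constructor
    · rintro ⟨n, j, hj, hx⟩
      exact (P.mem_space_iff x).2 ⟨n, j, by omega, hx⟩
    · intro hx
      obtain ⟨N, hN⟩ := exists_forall_ge_level hP hx
      exact ⟨N, hN N le_rfl⟩
  have hG1 : (⋃ n, G 1 n) =ᵐ[volume] P.space := by
    have h0 : ∀ᵐ x : ℝ, x ≠ 0 := by simp [ae_iff]
    filter_upwards [h0] with x hx0
    refine propext (Iff.trans (b := x ∈ ⋃ n, G 1 n) Iff.rfl ?_)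
    simp only [Set.mem_iUnion, hmem]
    constructor
    · rintro ⟨n, j, hj, hx⟩
      exact (P.mem_space_iff x).2 ⟨n, j + 1, hj, hx⟩
    · intro hx
      obtain ⟨N, hN⟩ := exists_forall_ge_level hP hx
      by_contra! hcon
      have hz : ∀ n ≥ N, x ∈ Set.Ico 0 (P.width n) := by
        intro n hn
        obtain ⟨j, hj, hxj⟩ := hN n hn
        rcases j with _ | j
        · rwa [level_zero_eq] at hxj
        · exact absurd hxj (hcon n j (by omega))
      have hle : x ≤ 0 := ge_of_tendsto P.tendsto_width
        (eventually_atTop.2 ⟨N, fun n hn => (hz n hn).2.le⟩)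
      exact hx0 (le_antisymm hle (hz N le_rfl).1)
  have hstep : ∀ n, volume (P.map ⁻¹' A ∩ G 0 n) = volume (A ∩ G 1 n) := by
    intro n
    rw [volume_inter_biUnion_level n _ hTA 0 zero_le_one,
      volume_inter_biUnion_level n _ hA 1 le_rfl]
    refine Finset.sum_congr rfl fun j hj => ?_
    exact volume_preimage_inter_level (by have := Finset.mem_range.1 hj; omega) A
  calc volume (P.map ⁻¹' A ∩ P.space) = volume (⋃ n, P.map ⁻¹' A ∩ G 0 n) := by
        rw [← hG0, Set.inter_iUnion]
    _ = volume (⋃ n, A ∩ G 1 n) := by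
        rw [Monotone.measure_iUnion, Monotone.measure_iUnion]
        · simp only [hstep]
        · exact fun a b h => Set.inter_subset_inter_right _ (hmono 1 le_rfl h)
        · exact fun a b h => Set.inter_subset_inter_right _ (hmono 0 zero_le_one h)
    _ = volume (A ∩ P.space) := by
        rw [← Set.inter_iUnion]
        exact measure_congr ((ae_eq_refl A).inter hG1)

theorem isInfinite_of_two_pow_le (h : ∀ n, 2 ^ n ≤ (P.height n : ℝ) * P.width n) :
    P.IsInfinite := by
  rw [IsInfinite, measure, Measure.restrict_apply_univ]
  refine ENNReal.eq_top_of_forall_nnreal_le fun c => ?_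
  obtain ⟨n, hn⟩ := pow_unbounded_of_one_lt (c : ℝ) one_lt_two
  calc (c : ENNReal) = ENNReal.ofReal c := (ENNReal.ofReal_coe_nnreal).symm
    _ ≤ ENNReal.ofReal (P.height n * P.width n) :=
        ENNReal.ofReal_le_ofReal (hn.le.trans (h n))
    _ = volume (Set.Ico 0 (P.height n * P.width n)) := by simp
    _ ≤ volume P.space := measure_mono fun x hx => (P.mem_space_iff x).2
        ⟨n, (P.mem_Ico_iff_exists_level n x).1 hx⟩

theorem width_eq_of_const {c : ℕ} (h : ∀ n, P.r n = c) (n : ℕ) : P.width n = 1 / (c : ℝ) ^ n := by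
  simp [width, h]

/-- The product of two levels of the same stage. -/
def rect (P Q : RankOne) (n j k : ℕ) : Set (ℝ × ℝ) := P.level n j ×ˢ Q.level n k

theorem measurableSet_rect (P Q : RankOne) (n j k : ℕ) : MeasurableSet (rect P Q n j k) :=
  (P.measurableSet_level n j).prod (Q.measurableSet_level n k)

theorem volume_rect (P Q : RankOne) (n j k : ℕ) :
    volume (rect P Q n j k) = ENNReal.ofReal (P.width n * Q.width n) := by
  rw [rect, Measure.volume_eq_prod, Measure.prod_prod, volume_level, volume_level,
    ENNReal.ofReal_mul (P.width_pos n).le]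

theorem dist_lt_width {P : RankOne} {n j : ℕ} {x y : ℝ} (hx : x ∈ P.level n j)
    (hy : y ∈ P.level n j) : dist x y < P.width n := by
  rw [Real.dist_eq, abs_lt]
  obtain ⟨h1, h2⟩ := hx
  obtain ⟨h3, h4⟩ := hy
  constructor <;> linarith

theorem exists_rect_density {P Q : RankOne} (hP : P.HasLastSpacer) (hQ : Q.HasLastSpacer)
    {A : Set (ℝ × ℝ)} (hA : MeasurableSet A) (hAs : A ⊆ P.space ×ˢ Q.space) (h0 : volume A ≠ 0)
    {η : ENNReal} (hη0 : η ≠ 0) (hη : η < 1) :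
    ∃ n, ∃ j < P.height (n + 1), ∃ k < Q.height (n + 1),
      η * volume (rect P Q (n + 1) j k) < volume (A ∩ rect P Q (n + 1) j k) := by
  classical
  by_contra! hcon
  obtain ⟨B, -, hBA, hB0, hBtop⟩ :=
    Measure.exists_subset_measure_lt_top hA (pos_iff_ne_zero.2 h0)
  have hηtop : η ≠ ⊤ := (hη.trans ENNReal.one_lt_top).ne
  have hlt : volume B < volume B * η⁻¹ := by
    conv_lhs => rw [← mul_one (volume B)]
    exact (ENNReal.mul_lt_mul_iff_right hB0.ne' hBtop.ne).2 (ENNReal.one_lt_inv.2 hη)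
  obtain ⟨U, hBU, hU, hUlt⟩ := Set.exists_isOpen_lt_of_lt B _ hlt
  let F : ℕ → Finset (ℕ × ℕ) := fun n =>
    (Finset.range (P.height (n + 1)) ×ˢ Finset.range (Q.height (n + 1))).filter
      fun p => rect P Q (n + 1) p.1 p.2 ⊆ U
  have hF : ∀ n p, p ∈ F n ↔ (p.1 < P.height (n + 1) ∧ p.2 < Q.height (n + 1)) ∧
      rect P Q (n + 1) p.1 p.2 ⊆ U := by
    intro n p
    simp [F]
  let V : ℕ → Set (ℝ × ℝ) := fun n => ⋃ p ∈ F n, rect P Q (n + 1) p.1 p.2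
  have hVmem : ∀ n z, z ∈ V n ↔ ∃ p ∈ F n, z ∈ rect P Q (n + 1) p.1 p.2 := by
    intro n z
    simp only [V, Set.mem_iUnion, exists_prop]
  have hmono : Monotone V := by
    refine monotone_nat_of_le_succ fun n z hz => ?_
    obtain ⟨p, hp, hz1, hz2⟩ := (hVmem n z).1 hz
    obtain ⟨⟨hp1, hp2⟩, hpU⟩ := (hF n p).1 hp
    obtain ⟨i, hi, hxi⟩ := P.exists_level_succ hp1 hz1
    obtain ⟨i', hi', hyi⟩ := Q.exists_level_succ hp2 hz2
    refine (hVmem _ z).2 ⟨(P.offset (n + 1) i + p.1, Q.offset (n + 1) i' + p.2), ?_, hxi, hyi⟩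
    exact (hF _ _).2 ⟨⟨P.offset_add_lt_height hi hp1, Q.offset_add_lt_height hi' hp2⟩,
      (Set.prod_mono (P.level_succ_subset hi hp1) (Q.level_succ_subset hi' hp2)).trans hpU⟩
  have hcover : B ⊆ ⋃ n, V n := by
    intro z hz
    obtain ⟨ε, hε, hball⟩ := Metric.isOpen_iff.1 hU z (hBU hz)
    obtain ⟨N, hN⟩ := exists_forall_ge_level hP (hAs (hBA hz)).1
    obtain ⟨N', hN'⟩ := exists_forall_ge_level hQ (hAs (hBA hz)).2
    obtain ⟨n, hn1, hn2, hn3, hn4⟩ := ((eventually_ge_atTop N).and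
      ((eventually_ge_atTop N').and ((P.tendsto_width.eventually_lt_const hε).and
        (Q.tendsto_width.eventually_lt_const hε)))).exists_forall_of_atTop.imp
        fun n h => (⟨(h (n + 1) (by omega)).1, (h (n + 1) (by omega)).2.1,
          (h (n + 1) (by omega)).2.2.1, (h (n + 1) (by omega)).2.2.2⟩ :
          N ≤ n + 1 ∧ N' ≤ n + 1 ∧ P.width (n + 1) < ε ∧ Q.width (n + 1) < ε)
    obtain ⟨j, hj, hxj⟩ := hN _ hn1
    obtain ⟨k, hk, hyk⟩ := hN' _ hn2
    refine Set.mem_iUnion.2 ⟨n, (hVmem n z).2 ⟨(j, k), (hF _ _).2 ⟨⟨by omega, by omega⟩, ?_⟩,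
      hxj, hyk⟩⟩
    rintro w ⟨hw1, hw2⟩
    refine hball ?_
    rw [Metric.mem_ball, Prod.dist_eq]
    exact max_lt ((dist_lt_width hw1 hxj).trans hn3) ((dist_lt_width hw2 hyk).trans hn4)
  have hbound : ∀ n, volume (B ∩ V n) ≤ η * volume U := by
    intro n
    have hV : volume (V n) = ∑ p ∈ F n, volume (rect P Q (n + 1) p.1 p.2) := by
      refine measure_biUnion_finset ?_ fun p _ => measurableSet_rect _ _ _ _ _
      intro p hp q hq hpq
      obtain ⟨⟨hp1, hp2⟩, -⟩ := (hF n p).1 hp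
      obtain ⟨⟨hq1, hq2⟩, -⟩ := (hF n q).1 hq
      refine Set.disjoint_left.2 fun z hz hz' => hpq ?_
      exact Prod.ext (P.level_unique hp1 hq1 hz.1 hz'.1) (Q.level_unique hp2 hq2 hz.2 hz'.2)
    calc volume (B ∩ V n) = volume (⋃ p ∈ F n, B ∩ rect P Q (n + 1) p.1 p.2) := by
          rw [Set.inter_iUnion₂]
      _ ≤ ∑ p ∈ F n, volume (B ∩ rect P Q (n + 1) p.1 p.2) := measure_biUnion_finset_le _ _
      _ ≤ ∑ p ∈ F n, η * volume (rect P Q (n + 1) p.1 p.2) := by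
          refine Finset.sum_le_sum fun p hp => ?_
          obtain ⟨⟨hp1, hp2⟩, -⟩ := (hF n p).1 hp
          exact (measure_mono (Set.inter_subset_inter_left _ hBA)).trans (hcon n _ hp1 _ hp2)
      _ = η * volume (V n) := by rw [hV, Finset.mul_sum]
      _ ≤ η * volume U := by
          gcongr
          exact Set.iUnion₂_subset fun p hp => ((hF n p).1 hp).2
  have hle : volume B ≤ η * volume U := by
    calc volume B = volume (⋃ n, B ∩ V n) := by
          rw [← Set.inter_iUnion, Set.inter_eq_left.2 hcover]
      _ = ⨆ n, volume (B ∩ V n) := Monotone.measure_iUnion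
          fun a b h => Set.inter_subset_inter_right _ (hmono h)
      _ ≤ _ := iSup_le hbound
  have hlt' : η * volume U < η * (volume B * η⁻¹) :=
    (ENNReal.mul_lt_mul_iff_right hη0 hηtop).2 hUlt
  rw [mul_comm (volume B), ← mul_assoc, ENNReal.mul_inv_cancel hη0 hηtop, one_mul] at hlt'
  exact absurd (hle.trans_lt hlt') (lt_irrefl _)

theorem volume_inter_rect_add_le {P Q : RankOne} {A : Set (ℝ × ℝ)} (hA : MeasurableSet A)
    (hret : ∀ z ∈ A, ∀ m ≠ 0, (Prod.map P.map Q.map)^[m] z ∉ A) {n j k a b : ℕ}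
    (hj : j < P.height n) (hk : k < Q.height n) (ha : a < P.r n) (hb : b < Q.r n)
    (ha0 : 0 < a) (hab : P.offset n a = Q.offset n b) :
    volume (A ∩ rect P Q n j k) + volume (rect P Q (n + 1) j k) ≤ volume (rect P Q n j k) := by
  set m := P.offset n a with hm
  have hm0 : m ≠ 0 := by
    have h1 := P.offset_add_height_le (n := n) ha0
    have h2 := P.height_pos n
    omega
  set R := rect P Q n j k
  set R₀ := rect P Q (n + 1) j k
  set R₁ := rect P Q (n + 1) (m + j) (m + k)
  have hjm : m + j < P.height (n + 1) := P.offset_add_lt_height ha hj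
  have hkm : m + k < Q.height (n + 1) := by
    rw [hab]
    exact Q.offset_add_lt_height hb hk
  have hR₀ : MeasurableSet R₀ := measurableSet_rect _ _ _ _ _
  have hR₁ : MeasurableSet R₁ := measurableSet_rect _ _ _ _ _
  have h₀ : R₀ ⊆ R := by
    refine Set.prod_mono ?_ ?_
    · simpa [offset_zero] using P.level_succ_subset (P.r_pos n) hj
    · simpa [offset_zero] using Q.level_succ_subset (Q.r_pos n) hk
  have h₁ : R₁ ⊆ R := by
    refine Set.prod_mono (P.level_succ_subset ha hj) ?_
    rw [hab]
    exact Q.level_succ_subset hb hk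
  have hdisj : Disjoint R₀ R₁ := by
    refine Set.disjoint_left.2 fun z hz hz' => ?_
    have := P.level_unique (by omega) hjm hz.1 hz'.1
    omega
  have hmove : volume (A ∩ R₀) ≤ volume (R₁ \ A) := by
    rw [← measure_preimage_add_right volume
      (P.left (n + 1) (m + j) - P.left (n + 1) j, Q.left (n + 1) (m + k) - Q.left (n + 1) k)
      (R₁ \ A)]
    refine measure_mono ?_
    rintro ⟨x, y⟩ ⟨hz, hx, hy⟩
    have e := hret _ hz m hm0
    rw [Prod.map_iterate, Prod.map_apply, P.iterate_map_of_mem (by omega) hx,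
      Q.iterate_map_of_mem (by omega) hy, add_comm j, add_comm k] at e
    exact ⟨⟨P.add_left_sub_mem_level.2 hx, Q.add_left_sub_mem_level.2 hy⟩, e⟩
  have hsub : A ∩ R ⊆ (R \ (R₀ ∪ R₁)) ∪ (A ∩ R₀ ∪ A ∩ R₁) := by
    intro z hz
    by_cases h : z ∈ R₀ ∪ R₁
    · exact Or.inr (h.imp (fun h => ⟨hz.1, h⟩) fun h => ⟨hz.1, h⟩)
    · exact Or.inl ⟨hz.2, h⟩
  calc volume (A ∩ R) + volume R₀
      ≤ (volume (R \ (R₀ ∪ R₁)) + (volume (A ∩ R₀) + volume (A ∩ R₁))) + volume R₀ := by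
        gcongr
        refine (measure_mono hsub).trans ((measure_union_le _ _).trans ?_)
        gcongr
        exact measure_union_le _ _
    _ ≤ (volume (R \ (R₀ ∪ R₁)) + (volume (R₁ \ A) + volume (R₁ ∩ A))) + volume R₀ := by
        rw [Set.inter_comm A R₁]
        gcongr
    _ = volume (R \ (R₀ ∪ R₁)) + volume (R₀ ∪ R₁) := by
        rw [measure_sdiff_add_inter R₁ hA, measure_union hdisj hR₁, add_assoc, add_comm (volume R₁)]
    _ = volume R := by
        rw [← measure_union Set.disjoint_sdiff_left (hR₀.union hR₁),
          Set.sdiff_union_of_subset (Set.union_subset h₀ h₁)]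

theorem measurePreserving_prodMap {P Q : RankOne} (hP : P.HasLastSpacer) (hQ : Q.HasLastSpacer) :
    MeasurePreserving (Prod.map P.map Q.map) (P.measure.prod Q.measure)
      (P.measure.prod Q.measure) := by
  have : SFinite P.measure := by unfold measure; infer_instance
  have : SFinite Q.measure := by unfold measure; infer_instance
  exact (measurePreserving_map hP).prod (measurePreserving_map hQ)

theorem conservative_prodMap {P Q : RankOne} (hP : P.HasLastSpacer) (hQ : Q.HasLastSpacer) (K : ℕ)
    (hPK : ∀ n, P.r n ≤ K) (hQK : ∀ n, Q.r n ≤ K)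
    (hoff : ∀ n, 1 ≤ n → ∃ a b, 0 < a ∧ a < P.r n ∧ b < Q.r n ∧ P.offset n a = Q.offset n b) :
    Conservative (Prod.map P.map Q.map) (P.measure.prod Q.measure) := by
  refine ⟨(measurePreserving_prodMap hP hQ).quasiMeasurePreserving, fun A hA h0 => ?_⟩
  by_contra! hcon
  rw [measure, measure, Measure.prod_restrict, Measure.restrict_apply hA,
    ← Measure.volume_eq_prod] at h0
  have hA' := hA.inter (P.measurableSet_space.prod Q.measurableSet_space)
  set B := A ∩ P.space ×ˢ Q.space with hB
  have hret : ∀ z ∈ B, ∀ m ≠ 0, (Prod.map P.map Q.map)^[m] z ∉ B :=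
    fun z hz m hm h => hcon z hz.1 m hm h.1
  have hK2 : (2 : ℝ) ≤ K := by exact_mod_cast (P.two_le_r 0).trans (hPK 0)
  have hinv0 : (0 : ℝ) < 1 / (K * K) := by positivity
  have hinv : 1 / (K * K : ℝ) < 1 := by
    rw [div_lt_one (by positivity)]
    nlinarith
  obtain ⟨n, j, hj, k, hk, hlt⟩ := exists_rect_density hP hQ hA' Set.inter_subset_right h0
    (η := ENNReal.ofReal (1 - 1 / (K * K))) (by simpa using hinv)
    (by rw [← ENNReal.ofReal_one]; exact (ENNReal.ofReal_lt_ofReal_iff one_pos).2 (by linarith))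
  obtain ⟨a, b, ha0, ha, hb, hab⟩ := hoff (n + 1) (by omega)
  have hle := volume_inter_rect_add_le hA' hret hj hk ha hb ha0 hab
  have hw := P.width_pos (n + 1 + 1)
  have hw' := Q.width_pos (n + 1 + 1)
  have hww := P.width_eq_mul (n + 1)
  have hww' := Q.width_eq_mul (n + 1)
  set w := P.width (n + 1 + 1)
  set w' := Q.width (n + 1 + 1)
  have hp : (P.r (n + 1) : ℝ) ≤ K := by exact_mod_cast hPK _
  have hq : (Q.r (n + 1) : ℝ) ≤ K := by exact_mod_cast hQK _
  have key : 1 / (K * K : ℝ) * (P.width (n + 1) * Q.width (n + 1)) ≤ w * w' := by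
    rw [hww, hww', one_div_mul_eq_div, div_le_iff₀ (by positivity)]
    calc P.r (n + 1) * w * (Q.r (n + 1) * w') ≤ K * w * (K * w') := by gcongr
      _ = w * w' * (K * K) := by ring
  have hW : 0 < P.width (n + 1) * Q.width (n + 1) :=
    mul_pos (P.width_pos _) (Q.width_pos _)
  have hrect : volume (rect P Q (n + 1) j k) ≠ ⊤ := by
    rw [volume_rect]
    exact ENNReal.ofReal_ne_top
  have h1 : volume (rect P Q (n + 1) j k) < volume (B ∩ rect P Q (n + 1) j k) +
      volume (rect P Q (n + 1 + 1) j k) := by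
    calc volume (rect P Q (n + 1) j k)
        ≤ ENNReal.ofReal (1 - 1 / (K * K)) * volume (rect P Q (n + 1) j k) +
          volume (rect P Q (n + 1 + 1) j k) := by
          rw [volume_rect, volume_rect, ← ENNReal.ofReal_mul (by linarith),
            ← ENNReal.ofReal_add (mul_nonneg (by linarith) hW.le) (by positivity)]
          refine ENNReal.ofReal_le_ofReal ?_
          linarith
      _ < _ := by
          refine ENNReal.add_lt_add_right ?_ hlt
          rw [volume_rect]
          exact ENNReal.ofReal_ne_top
  exact absurd h1 (not_lt.2 hle)

/-- The heights in `C_{n+1}` of the descendants of the bottom level of `C_1`. -/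
def descendants (P : RankOne) : ℕ → Set ℕ
  | 0 => {0}
  | n + 1 => {k | ∃ i < P.r (n + 1), ∃ p ∈ P.descendants n, k = P.offset (n + 1) i + p}

theorem exists_descendant {P : RankOne} {c : ℕ} (hc : c < P.height 1) {x : ℝ}
    (hx : x ∈ P.level 1 c) (n : ℕ) :
    ∃ p ∈ P.descendants n, p + c < P.height (n + 1) ∧ x ∈ P.level (n + 1) (p + c) := by
  induction n with
  | zero => exact ⟨0, rfl, by simpa using hc, by simpa using hx⟩
  | succ n ih =>
    obtain ⟨p, hp, hpc, hxp⟩ := ih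
    obtain ⟨i, hi, hxi⟩ := P.exists_level_succ hpc hxp
    refine ⟨_, ⟨i, hi, p, hp, rfl⟩, ?_, ?_⟩
    · rw [add_assoc]
      exact P.offset_add_lt_height hi hpc
    · rwa [add_assoc (P.offset _ _)]

/-- The set of pairs of points whose heights in the columns of stage `n + 1` differ as the heights
of some descendants of the bottom levels of the columns of stage `1`. -/
def alignedAt (P Q : RankOne) (n : ℕ) : Set (ℝ × ℝ) :=
  ⋃ j, ⋃ k, ⋃ (_ : j < P.height (n + 1) ∧ k < Q.height (n + 1) ∧
    ∃ p ∈ P.descendants n, ∃ q ∈ Q.descendants n, j + q = p + k), rect P Q (n + 1) j k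

/-- The set of pairs of points that are eventually aligned. -/
def aligned (P Q : RankOne) : Set (ℝ × ℝ) := ⋃ N, ⋂ n, ⋂ (_ : N ≤ n), alignedAt P Q n

theorem measurableSet_aligned (P Q : RankOne) : MeasurableSet (aligned P Q) :=
  .iUnion fun _ => .iInter fun _ => .iInter fun _ =>
    .iUnion fun _ => .iUnion fun _ => .iUnion fun _ => measurableSet_rect _ _ _ _ _

theorem mem_aligned_iff {P Q : RankOne} (z : ℝ × ℝ) :
    z ∈ aligned P Q ↔ ∃ N, ∀ n ≥ N, z ∈ alignedAt P Q n := by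
  simp [aligned]

theorem mem_alignedAt_iff {P Q : RankOne} {n j k : ℕ} {z : ℝ × ℝ} (hj : j < P.height (n + 1))
    (hk : k < Q.height (n + 1)) (hx : z.1 ∈ P.level (n + 1) j) (hy : z.2 ∈ Q.level (n + 1) k) :
    z ∈ alignedAt P Q n ↔ ∃ p ∈ P.descendants n, ∃ q ∈ Q.descendants n, j + q = p + k := by
  simp only [alignedAt, Set.mem_iUnion, exists_prop]
  constructor
  · rintro ⟨j', k', ⟨hj', hk', h⟩, hx', hy'⟩
    rwa [P.level_unique hj hj' hx hx', Q.level_unique hk hk' hy hy']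
  · exact fun h => ⟨j, k, ⟨hj, hk, h⟩, hx, hy⟩

theorem aligned_subset (P Q : RankOne) : aligned P Q ⊆ P.space ×ˢ Q.space := by
  intro z hz
  obtain ⟨N, hN⟩ := (mem_aligned_iff z).1 hz
  have h := hN N le_rfl
  simp only [alignedAt, Set.mem_iUnion, exists_prop] at h
  obtain ⟨j, k, ⟨hj, hk, -⟩, hx, hy⟩ := h
  exact ⟨(P.mem_space_iff _).2 ⟨_, j, hj, hx⟩, (Q.mem_space_iff _).2 ⟨_, k, hk, hy⟩⟩

theorem preimage_aligned {P Q : RankOne} (hP : P.HasLastSpacer) (hQ : Q.HasLastSpacer) :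
    Prod.map P.map Q.map ⁻¹' aligned P Q = aligned P Q := by
  ext z
  rw [Set.mem_preimage]
  by_cases hz : z ∈ P.space ×ˢ Q.space
  · obtain ⟨N₁, h₁⟩ := exists_forall_ge_level hP hz.1
    obtain ⟨N₂, h₂⟩ := exists_forall_ge_level hQ hz.2
    have hstep : ∀ n ≥ max N₁ N₂,
        (Prod.map P.map Q.map z ∈ alignedAt P Q n ↔ z ∈ alignedAt P Q n) := by
      intro n hn
      obtain ⟨j, hj, hx⟩ := h₁ (n + 1) (by omega)
      obtain ⟨k, hk, hy⟩ := h₂ (n + 1) (by omega)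
      rw [mem_alignedAt_iff (by omega) (by omega) hx hy,
        mem_alignedAt_iff hj hk (P.map_mem_level hj hx) (Q.map_mem_level hk hy)]
      refine exists_congr fun p => and_congr_right fun _ =>
        exists_congr fun q => and_congr_right fun _ => ?_
      omega
    rw [mem_aligned_iff, mem_aligned_iff]
    constructor
    · rintro ⟨N, hN⟩
      exact ⟨max N (max N₁ N₂), fun n hn => (hstep n (by omega)).1 (hN n (by omega))⟩
    · rintro ⟨N, hN⟩
      exact ⟨max N (max N₁ N₂), fun n hn => (hstep n (by omega)).2 (hN n (by omega))⟩
  · refine iff_of_false (fun h => hz ?_) fun h => hz (aligned_subset P Q h)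
    have h' := aligned_subset P Q h
    exact ⟨(map_mem_space hP).1 h'.1, (map_mem_space hQ).1 h'.2⟩

theorem prod_measure_rect_ne_zero (P Q : RankOne) {n j k : ℕ} (hj : j < P.height n)
    (hk : k < Q.height n) : (P.measure.prod Q.measure) (rect P Q n j k) ≠ 0 := by
  rw [measure, measure, Measure.prod_restrict, Measure.restrict_apply (measurableSet_rect _ _ _ _ _),
    Set.inter_eq_left.2, ← Measure.volume_eq_prod, volume_rect]
  · simpa using mul_pos (P.width_pos n) (Q.width_pos n)
  · exact Set.prod_mono (fun x hx => (P.mem_space_iff x).2 ⟨n, j, hj, hx⟩)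
      fun y hy => (Q.mem_space_iff y).2 ⟨n, k, hk, hy⟩

theorem not_ergodic_prodMap {P Q : RankOne} (hP : P.HasLastSpacer) (hQ : Q.HasLastSpacer)
    (h1 : 1 < Q.height 1)
    (hdesc : ∀ n, ∀ p ∈ P.descendants n, ∀ p' ∈ P.descendants n, ∀ q ∈ Q.descendants n,
      ∀ q' ∈ Q.descendants n, p + q' ≠ p' + q + 1) :
    ¬ Ergodic (Prod.map P.map Q.map) (P.measure.prod Q.measure) := by
  intro herg
  have hsub : rect P Q 1 0 0 ⊆ aligned P Q := by
    rintro z ⟨hx, hy⟩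
    refine (mem_aligned_iff z).2 ⟨0, fun n _ => ?_⟩
    obtain ⟨p, hp, hp1, hxp⟩ := exists_descendant (P.height_pos 1) hx n
    obtain ⟨q, hq, hq1, hyq⟩ := exists_descendant (Q.height_pos 1) hy n
    exact (mem_alignedAt_iff hp1 hq1 hxp hyq).2 ⟨p, hp, q, hq, rfl⟩
  have hsub' : rect P Q 1 0 1 ⊆ (aligned P Q)ᶜ := by
    rintro z ⟨hx, hy⟩ hz
    obtain ⟨n, hn⟩ := (mem_aligned_iff z).1 hz
    obtain ⟨p, hp, hp1, hxp⟩ := exists_descendant (P.height_pos 1) hx n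
    obtain ⟨q, hq, hq1, hyq⟩ := exists_descendant h1 hy n
    obtain ⟨p', hp', q', hq', e⟩ := (mem_alignedAt_iff hp1 hq1 hxp hyq).1 (hn n le_rfl)
    exact hdesc n p hp p' hp' q hq q' hq' (by omega)
  rcases herg.toPreErgodic.measure_self_or_compl_eq_zero (measurableSet_aligned P Q)
    (preimage_aligned hP hQ) with h | h
  · exact prod_measure_rect_ne_zero P Q (P.height_pos 1) (Q.height_pos 1)
      (measure_mono_null hsub h)
  · exact prod_measure_rect_ne_zero P Q (P.height_pos 1) h1 (measure_mono_null hsub' h)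

/-- The offset of the last subcolumn. -/
def lastOffset (P : RankOne) (n : ℕ) : ℕ := P.offset n (P.r n - 1)

theorem height_le_lastOffset (P : RankOne) (n : ℕ) : P.height n ≤ P.lastOffset n := by
  have h := P.two_le_r n
  have := P.offset_add_height_le (n := n) (show 0 < P.r n - 1 by omega)
  rw [offset_zero] at this
  unfold lastOffset
  omega

theorem height_succ_eq (P : RankOne) (n : ℕ) :
    P.height (n + 1) = P.lastOffset n + (P.height n + P.s n (P.r n - 1)) := by
  have h := P.offset_succ n (P.r n - 1)
  rwa [Nat.sub_add_cancel (P.r_pos n)] at h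

theorem LargeLastSpacers.two_mul_le {P : RankOne} (hP : P.LargeLastSpacers) (n : ℕ) :
    2 * (P.lastOffset n + P.height n) ≤ P.height (n + 1) := by
  have h := hP (n + 1) (by omega)
  rw [Nat.add_sub_cancel, div_le_iff₀ two_pos] at h
  have h' : P.height (n + 1) ≤ P.s n (P.r n - 1) * 2 := by exact_mod_cast h
  have := P.height_succ_eq n
  omega

theorem LargeLastSpacers.hasLastSpacer {P : RankOne} (hP : P.LargeLastSpacers) :
    P.HasLastSpacer := by
  intro n
  have h := hP.two_mul_le n
  have := P.height_succ_eq n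
  have := P.height_pos n
  omega

theorem LargeLastSpacers.four_pow_le_height {P : RankOne} (hP : P.LargeLastSpacers) (n : ℕ) :
    4 ^ n ≤ P.height n := by
  induction n with
  | zero => exact le_rfl
  | succ n ih =>
    have h := hP.two_mul_le n
    have := P.height_le_lastOffset n
    rw [pow_succ]
    omega

/-- Heights of the columns of the skyscraper transformation associated with `P`. -/
def skyscraperHeight (P : RankOne) : ℕ → ℕ
  | 0 => 1
  | n + 1 => P.lastOffset (n + 1)

/-- The skyscraper transformation whose column of stage `n ≥ 1` is as high as the offset of the
last subcolumn of the column of stage `n` of `P`. -/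
def skyscraper (P : RankOne) : RankOne where
  r _ := 2
  s n i := if i = 0 then 0 else P.skyscraperHeight (n + 1) - 2 * P.skyscraperHeight n
  two_le_r _ := le_rfl

theorem LargeLastSpacers.skyscraperHeight_succ {P : RankOne} (hP : P.LargeLastSpacers) (n : ℕ) :
    2 * P.skyscraperHeight n + 2 ≤ P.skyscraperHeight (n + 1) := by
  have h1 : P.skyscraperHeight n ≤ P.lastOffset n := by
    cases n with
    | zero => exact P.height_le_lastOffset 0
    | succ n => exact le_rfl
  have h2 := hP.two_mul_le n
  have h3 := P.height_pos n
  have h4 : P.height (n + 1) ≤ P.skyscraperHeight (n + 1) := P.height_le_lastOffset (n + 1)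
  omega

theorem LargeLastSpacers.height_skyscraper {P : RankOne} (hP : P.LargeLastSpacers) (n : ℕ) :
    P.skyscraper.height n = P.skyscraperHeight n := by
  induction n with
  | zero => rfl
  | succ n ih =>
    have h := hP.skyscraperHeight_succ n
    have hr : P.skyscraper.r n = 2 := rfl
    have h0 : P.skyscraper.s n 0 = 0 := rfl
    have h1 : P.skyscraper.s n 1 = P.skyscraperHeight (n + 1) - 2 * P.skyscraperHeight n := rfl
    simp only [height, ih, hr, h0, h1, Finset.sum_range_succ, Finset.sum_range_zero]
    omega

theorem LargeLastSpacers.offset_skyscraper_one {P : RankOne} (hP : P.LargeLastSpacers) (n : ℕ) :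
    P.skyscraper.offset (n + 1) 1 = P.lastOffset (n + 1) := by
  have h0 : P.skyscraper.s (n + 1) 0 = 0 := rfl
  rw [offset, Finset.sum_range_one, h0, hP.height_skyscraper]
  rfl

theorem LargeLastSpacers.hasLastSpacer_skyscraper {P : RankOne} (hP : P.LargeLastSpacers) :
    P.skyscraper.HasLastSpacer := by
  intro n
  have h := hP.skyscraperHeight_succ n
  change 1 ≤ P.skyscraperHeight (n + 1) - 2 * P.skyscraperHeight n
  omega

theorem LargeLastSpacers.isSkyscraper_skyscraper {P : RankOne} (hP : P.LargeLastSpacers) :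
    P.skyscraper.IsSkyscraper := by
  refine ⟨fun _ => rfl, fun _ => rfl, isInfinite_of_two_pow_le fun n => ?_⟩
  have h4 : 4 ^ n ≤ P.skyscraperHeight n := by
    cases n with
    | zero => exact le_rfl
    | succ n => exact (hP.four_pow_le_height _).trans (P.height_le_lastOffset _)
  have h4' : (4 : ℝ) ^ n ≤ P.skyscraperHeight n := by exact_mod_cast h4
  rw [hP.height_skyscraper, width_eq_of_const (c := 2) fun _ => rfl, mul_one_div,
    le_div_iff₀ (by positivity), ← mul_pow]
  norm_num
  exact h4'

theorem LargeLastSpacers.descendants_le {P : RankOne} (hP : P.LargeLastSpacers) (n : ℕ) :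
    ∃ M, 2 * M + 2 ≤ P.height (n + 1) ∧ (∀ p ∈ P.descendants n, p ≤ M) ∧
      ∀ q ∈ P.skyscraper.descendants n, q ≤ M := by
  induction n with
  | zero =>
    refine ⟨0, ?_, fun p hp => Nat.le_of_eq hp, fun q hq => Nat.le_of_eq hq⟩
    have := hP.two_mul_le 0
    have := P.height_pos 0
    omega
  | succ n ih =>
    obtain ⟨M, hM, hp, hq⟩ := ih
    refine ⟨P.lastOffset (n + 1) + M, ?_, ?_, ?_⟩
    · have := hP.two_mul_le (n + 1)
      omega
    · rintro _ ⟨i, hi, p, hp', rfl⟩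
      exact Nat.add_le_add (P.offset_mono _ (by omega)) (hp p hp')
    · rintro _ ⟨i, hi, q, hq', rfl⟩
      rw [← hP.offset_skyscraper_one]
      have hi2 : i < 2 := hi
      exact Nat.add_le_add (P.skyscraper.offset_mono _ (by omega)) (hq q hq')

theorem LargeLastSpacers.descendants_add_ne {P : RankOne} (hP : P.LargeLastSpacers) (n : ℕ) :
    ∀ p ∈ P.descendants n, ∀ p' ∈ P.descendants n, ∀ q ∈ P.skyscraper.descendants n,
      ∀ q' ∈ P.skyscraper.descendants n, p + q' ≠ p' + q + 1 := by
  induction n with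
  | zero =>
    rintro p hp p' hp' q hq q' hq'
    rw [show p = 0 from hp, show p' = 0 from hp', show q = 0 from hq, show q' = 0 from hq']
    omega
  | succ n ih =>
    obtain ⟨M, hM, hpM, hqM⟩ := hP.descendants_le n
    have hgap : ∀ i i', i < i' → P.offset (n + 1) i + P.height (n + 1) ≤ P.offset (n + 1) i' :=
      fun _ _ h => P.offset_add_height_le h
    have hlast : ∀ i < P.r (n + 1), i = P.r (n + 1) - 1 ∨
        P.offset (n + 1) i + P.height (n + 1) ≤ P.lastOffset (n + 1) :=
      fun i hi => or_iff_not_imp_left.2 fun h => hgap _ _ (by omega)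
    have hfirst : ∀ i, i = 0 ∨ P.height (n + 1) ≤ P.offset (n + 1) i := by
      intro i
      rcases Nat.eq_zero_or_pos i with h | h
      · exact Or.inl h
      · have := hgap 0 i h
        rw [offset_zero] at this
        exact Or.inr (by omega)
    have hle : ∀ i < P.r (n + 1), P.offset (n + 1) i ≤ P.lastOffset (n + 1) :=
      fun i hi => P.offset_mono _ (by omega)
    have ho0 := P.offset_zero (n + 1)
    have hol : P.offset (n + 1) (P.r (n + 1) - 1) = P.lastOffset (n + 1) := rfl
    have hs0 := P.skyscraper.offset_zero (n + 1)
    have hs1 := hP.offset_skyscraper_one n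
    rintro _ ⟨i, hi, p, hp, rfl⟩ _ ⟨i', hi', p', hp', rfl⟩ _ ⟨c, hc, q, hq, rfl⟩
      _ ⟨c', hc', q', hq', rfl⟩ e
    have hne := ih p hp p' hp' q hq q' hq'
    have b1 := hpM p hp
    have b2 := hpM p' hp'
    have b3 := hqM q hq
    have b4 := hqM q' hq'
    have hc2 : c < 2 := hc
    have hc2' : c' < 2 := hc'
    have f1 := hfirst i
    have f2 := hfirst i'
    have l1 := hlast i hi
    have l2 := hlast i' hi'
    have k1 := hle i hi
    have k2 := hle i' hi'
    have heq : c = c' → False := by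
      rintro rfl
      rcases lt_trichotomy i i' with h | rfl | h
      · have := hgap _ _ h
        omega
      · omega
      · have := hgap _ _ h
        omega
    have hcc : (c = 0 ∧ c' = 1) ∨ (c = 1 ∧ c' = 0) := by
      have : c ≠ c' := heq
      omega
    rcases hcc with ⟨rfl, rfl⟩ | ⟨rfl, rfl⟩
    · rw [hs0, hs1] at e
      rcases f1 with rfl | f1
      · rcases l2 with rfl | l2
        · omega
        · omega
      · omega
    · rw [hs0, hs1] at e
      rcases f2 with rfl | f2
      · rcases l1 with rfl | l1
        · omega
        · omega
      · omega

theorem chacon_isInfinite : chacon.IsInfinite := by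
  refine isInfinite_of_two_pow_le fun n => ?_
  have h : ∀ n, 6 ^ n ≤ chaconHeight n := by
    intro n
    induction n with
    | zero => exact le_rfl
    | succ n ih =>
      rw [chaconHeight, pow_succ]
      omega
  have h' : (6 : ℝ) ^ n ≤ chaconHeight n := by exact_mod_cast h n
  rw [height_chacon, width_eq_of_const (c := 3) fun _ => rfl, mul_one_div,
    le_div_iff₀ (by positivity)]
  push_cast
  rw [← mul_pow]
  norm_num
  exact h'

theorem chacon_largeLastSpacers : chacon.LargeLastSpacers := by
  intro n hn
  obtain ⟨n, rfl⟩ := Nat.exists_eq_add_of_le' hn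
  have hs : chacon.s (n + 1 - 1) (chacon.r (n + 1 - 1) - 1) = 3 * chaconHeight n + 1 := rfl
  rw [hs, height_chacon, chaconHeight]
  push_cast
  linarith

theorem hajianKakutani_isInfinite : hajianKakutani.IsInfinite := by
  refine isInfinite_of_two_pow_le fun n => ?_
  rw [height_hajianKakutani, width_eq_of_const (c := 2) fun _ => rfl, mul_one_div,
    le_div_iff₀ (by positivity)]
  push_cast
  rw [← mul_pow]
  norm_num

theorem hajianKakutani_largeLastSpacers : hajianKakutani.LargeLastSpacers := by
  intro n hn
  obtain ⟨n, rfl⟩ := Nat.exists_eq_add_of_le' hn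
  have hs : hajianKakutani.s (n + 1 - 1) (hajianKakutani.r (n + 1 - 1) - 1) = 2 * 4 ^ n := rfl
  rw [hs, height_hajianKakutani]
  push_cast
  rw [pow_succ]
  linarith

end RankOne

theorem mainTheorem6 :
    (∀ T : RankOne, T.IsInfinite → T.BoundedCuts → T.LargeLastSpacers →
      ∃ S : RankOne, S.IsSkyscraper ∧
        MeasurePreserving (Prod.map T.map S.map)
          (T.measure.prod S.measure) (T.measure.prod S.measure) ∧
        Conservative (Prod.map T.map S.map) (T.measure.prod S.measure) ∧
        ¬ Ergodic (Prod.map T.map S.map) (T.measure.prod S.measure)) ∧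
    (RankOne.chacon.IsInfinite ∧ RankOne.chacon.BoundedCuts ∧
      RankOne.chacon.LargeLastSpacers) ∧
    (RankOne.hajianKakutani.IsInfinite ∧ RankOne.hajianKakutani.BoundedCuts ∧
      RankOne.hajianKakutani.LargeLastSpacers) := by
  refine ⟨fun T _ hK hT => ?_,
    ⟨RankOne.chacon_isInfinite, ⟨3, fun _ => le_rfl⟩, RankOne.chacon_largeLastSpacers⟩,
    ⟨RankOne.hajianKakutani_isInfinite, ⟨2, fun _ => le_rfl⟩,
      RankOne.hajianKakutani_largeLastSpacers⟩⟩
  obtain ⟨K, hK⟩ := hK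
  refine ⟨T.skyscraper, hT.isSkyscraper_skyscraper,
    RankOne.measurePreserving_prodMap hT.hasLastSpacer hT.hasLastSpacer_skyscraper,
    RankOne.conservative_prodMap hT.hasLastSpacer hT.hasLastSpacer_skyscraper K hK
      (fun _ => (T.two_le_r 0).trans (hK 0)) ?_,
    RankOne.not_ergodic_prodMap hT.hasLastSpacer hT.hasLastSpacer_skyscraper ?_
      hT.descendants_add_ne⟩
  · intro n hn
    obtain ⟨n, rfl⟩ := Nat.exists_eq_add_of_le' hn
    have h2 := T.two_le_r (n + 1)
    exact ⟨T.r (n + 1) - 1, 1, by omega, by omega, one_lt_two, (hT.offset_skyscraper_one n).symm⟩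
  · have : 2 * T.skyscraperHeight 0 + 2 ≤ T.skyscraperHeight 1 := hT.skyscraperHeight_succ 0
    rw [hT.height_skyscraper]
    omega
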